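/- **Theorem.** Let $V$ be a finite nonempty set and let $K$ be an abstract simplicial complex on $V$, i.e. a family of nonempty subsets of $V$ (faces) that contains all singletons and is closed under passing to nonempty subsets; put $\dim\sigma=\#\sigma-1$ and $\dim K=\max_{\sigma\in K}\dim\sigma$. Let $f:K\to\mathbb R$ be an injective discrete Morse function, that is, for every $\sigma\in K$ the sets $$U(\sigma)=\{\tau\in K:\tau\supset\sigma,\ \dim\tau=\dim\sigma+1,\ f(\tau)\le f(\sigma)\},\qquad L(\sigma)=\{\nu\in K:\nu\subset\sigma,\ \dim\nu=\dim\sigma-1,\ f(\nu)\ge f(\sigma)\}$$ have at most one element each; $\sigma$ is critical if $U(\sigma)=L(\sigma)=\varnothing$. Let $S_K$ be the order complex of $K$: its vertices are the faces of $K$ and its simplices are the nonempty chains $\mathcal C\subset K$ with respect to inclusion. It is realized in $\mathbb R^V$ as $|S_K|=\bigcup_{\mathcal C\in S_K}\operatorname{conv}(\mathbf 1_\sigma:\sigma\in\mathcal C)$, where $\mathbf 1_\sigma$ is the indicator vector. For $L\subset K$ let $S_K(L)$ be the induced subcomplex of $S_K$ on the vertex set $L$, and $|S_K(L)|\subset|S_K|$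 its realization. On $|S_K|$ let $f^L$ be the Lovász extension $$f^L(x)=\int_{\min_i x_i}^{\max_i x_i} f(\{i\in V:x_i>t\})\,dt+f(V)\min_i x_i ,$$ where $f$ is set to $0$ on subsets of $V$ that are not in $K$ (on $|S_K|$ the formula does not depend on these values). Call $U\subset|S_K|$ contractible in $|S_K|$ if the inclusion $U\hookrightarrow|S_K|$ is null-homotopic. For $S\subset|S_K|$ let $\mathrm{cat}(S)$ be the least integer $k\ge0$ such that $S$ is contained in the union of $k+1$ subsets of $|S_K|$ that are contractible in $|S_K|$. For $m\ge0$ put $$\mathrm{Cat}_m(K)=\{\varnothing\ne L\subset K:\mathrm{cat}(|S_K(L)|)\ge m\},\qquad \mathrm{Cat}_m(|S_K|)=\{\varnothing\ne S\subset|S_K|:\mathrm{cat}(S)\ge m\}.$$ Then for every $m=0,1,\dots,\dim K$ $$\min_{L\in\mathrm{Cat}_m(K)}\max_{\sigma\in L}f(\sigma)=\inf_{S\in\mathrm{Cat}_m(|S_K|)}\ \sup_{x\in S}f^L(x),$$ in the following sense: $\mathrm{Cat}_m(K)$ is nonempty if and only if $\mathrm{Cat}_m(|S_K|)$ is nonempty,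 and in that case the minimum on the left is attained and both sides are equal to the same real number $c$. Moreover $c$ is a critical value of $f$, i.e. $c=f(\sigma)$ for a critical face $\sigma$, and a critical value of $F=f^L|_{|S_K|}$, i.e. $c=F(a)$ for some $a\in|S_K|$ at which the weak slope of $F$ vanishes. Here the weak slope $|dF|(a)$ is the supremum of all $\varepsilon\ge0$ for which there are $\delta>0$ and a continuous map $H:B_\delta(a)\times[0,\delta]\to|S_K|$ with $F(H(x,t))\le F(x)-\varepsilon t$ and $\mathrm{dist}(H(x,t),x)\le t$ for all $x\in B_\delta(a)$, $t\in[0,\delta]$, the distance being that of the $\ell^\infty$ norm of $\mathbb R^V$. -/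

import Mathlib

open scoped NNReal ENNReal

noncomputable section

namespace DiscreteMorseLS

/-! ### The order complex and its geometric realization -/

section Complex

variable {V : Type*}

/-- The dimension of a finite simplicial complex: the largest value of `#σ - 1` over its
(nonempty) faces `σ`. -/
def dimension [Finite V] (K : AbstractSimplicialComplex V) : ℕ :=
  ⨆ σ : K.faces, (σ.1.card - 1)

/-- The order complex `S_K`: its vertices are the faces of `K`, its simplices are the nonempty
chains of faces of `K`, ordered by inclusion. -/
def orderComplex (K : AbstractSimplicialComplex V) : AbstractSimplicialComplex K.faces where
  faces := {C | C.Nonempty ∧ IsChain (· ≤ ·) (C : Set K.faces)}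
  isRelLowerSet_faces := fun _ hC =>
    ⟨hC.1, fun _ hD hne => ⟨hne, hC.2.mono (Finset.coe_subset.mpr hD)⟩⟩
  singleton_mem := fun σ => ⟨Finset.singleton_nonempty σ, by simp⟩

/-- The induced subcomplex of a simplicial complex on a set `L` of vertices. -/
def inducedSubcomplex {W : Type*} (S : AbstractSimplicialComplex W) (L : Set W) :
    PreAbstractSimplicialComplex W where
  faces := {C | C ∈ S.faces ∧ (C : Set W) ⊆ L}
  isRelLowerSet_faces := fun _ hC =>
    ⟨(S.isRelLowerSet_faces hC.1).1, fun _ hD hne =>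
      ⟨(S.isRelLowerSet_faces hC.1).2 hD hne, (Finset.coe_subset.mpr hD).trans hC.2⟩⟩

/-- The indicator vector `1_A ∈ ℝ^V` of a set `A ⊆ V`. -/
def indicatorVector (A : Finset V) : V → ℝ :=
  Set.indicator (A : Set V) (fun _ => 1)

/-- The realization in `ℝ^V` of a complex `T` whose vertices are faces of `K`: the union over the
simplices `C` of `T` of the convex hulls of `{1_σ : σ ∈ C}`. -/
def realization {K : AbstractSimplicialComplex V} (T : PreAbstractSimplicialComplex K.faces) :
    Set (V → ℝ) :=
  ⋃ C ∈ T.faces, convexHull ℝ ((fun σ : K.faces => indicatorVector σ.1) '' (C : Set K.faces))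

/-- The space `|S_K|`, with the metric induced from the `ℓ^∞` metric of `ℝ^V`. -/
abbrev OrderSpace (K : AbstractSimplicialComplex V) : Type _ :=
  ↥(realization (orderComplex K).toPreAbstractSimplicialComplex)

/-- `|S_K(L)|`, as a subset of the space `|S_K|`. -/
def orderSubspace (K : AbstractSimplicialComplex V) (L : Set K.faces) : Set (OrderSpace K) :=
  {x | x.1 ∈ realization (inducedSubcomplex (orderComplex K) L)}

end Complex

/-! ### The Lusternik–Schnirelmann category of a subset -/

/-- A subset `U` of `X` is contractible in `X` if the inclusion `U ↪ X` is null-homotopic. -/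
def ContractibleIn {X : Type*} [TopologicalSpace X] (U : Set X) : Prop :=
  (⟨Subtype.val, continuous_subtype_val⟩ : C(U, X)).Nullhomotopic

/-- The (normalized) Lusternik–Schnirelmann category of `S ⊆ X`: the least `k` such that `S` is
covered by `k + 1` subsets of `X` that are contractible in `X` (`⊤` if there is no such `k`). -/
def lsCat {X : Type*} [TopologicalSpace X] (S : Set X) : ℕ∞ :=
  ⨅ (k : ℕ) (_ : ∃ U : Fin (k + 1) → Set X, (∀ i, ContractibleIn (U i)) ∧ S ⊆ ⋃ i, U i), (k : ℕ∞)

section Complex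

variable {V : Type*}

/-- `Cat_m(K)`: the nonempty sets `L` of faces of `K` with `cat(|S_K(L)|) ≥ m`. -/
def discreteCatClass (K : AbstractSimplicialComplex V) (m : ℕ) : Set (Set K.faces) :=
  {L | L.Nonempty ∧ (m : ℕ∞) ≤ lsCat (orderSubspace K L)}

/-- `Cat_m(|S_K|)`: the nonempty subsets `S` of `|S_K|` with `cat(S) ≥ m`. -/
def continuousCatClass (K : AbstractSimplicialComplex V) (m : ℕ) : Set (Set (OrderSpace K)) :=
  {S | S.Nonempty ∧ (m : ℕ∞) ≤ lsCat S}

/-! ### Discrete Morse functions -/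

/-- `U(σ)`: the cofaces `τ ⊃ σ` of dimension one more with `f(τ) ≤ f(σ)`. -/
def upperSet {K : AbstractSimplicialComplex V} (f : K.faces → ℝ) (σ : K.faces) : Set K.faces :=
  {τ | σ.1 ⊆ τ.1 ∧ τ.1.card = σ.1.card + 1 ∧ f τ ≤ f σ}

/-- `L(σ)`: the faces `ν ⊂ σ` of dimension one less with `f(ν) ≥ f(σ)`. -/
def lowerSet {K : AbstractSimplicialComplex V} (f : K.faces → ℝ) (σ : K.faces) : Set K.faces :=
  {ν | ν.1 ⊆ σ.1 ∧ ν.1.card + 1 = σ.1.card ∧ f σ ≤ f ν}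

/-- Forman's discrete Morse functions. -/
def IsDiscreteMorse {K : AbstractSimplicialComplex V} (f : K.faces → ℝ) : Prop :=
  ∀ σ : K.faces, (upperSet f σ).encard ≤ 1 ∧ (lowerSet f σ).encard ≤ 1

/-- `c` is a critical value of the discrete function `f`: the value of `f` at a critical face. -/
def IsDiscreteCriticalValue {K : AbstractSimplicialComplex V} (f : K.faces → ℝ) (c : ℝ) : Prop :=
  ∃ σ : K.faces, upperSet f σ = ∅ ∧ lowerSet f σ = ∅ ∧ f σ = c

end Complex

/-! ### The Lovász extension -/

section Lovasz

variable {V : Type*} [Fintype V]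

/-- The Lovász extension of a set function `g`:
`g^L(x) = ∫_{min x}^{max x} g({i : x_i > t}) dt + g(V) min x`. -/
def lovaszExtension (g : Finset V → ℝ) (x : V → ℝ) : ℝ :=
  (∫ t in (⨅ i, x i)..(⨆ i, x i), g (Finset.univ.filter fun i => t < x i)) +
    g Finset.univ * ⨅ i, x i

open Classical in
/-- Extension of a function on the faces of `K` by zero to all subsets of `V`. The value chosen
outside `K` does not influence the Lovász extension on `|S_K|`. -/
def extendByZero {K : AbstractSimplicialComplex V} (f : K.faces → ℝ) (A : Finset V) : ℝ :=
  if h : A ∈ K.faces then f ⟨A, h⟩ else 0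

/-- The restriction of the Lovász extension `f^L` to `|S_K|`. -/
def lovaszOnOrderSpace {K : AbstractSimplicialComplex V} (f : K.faces → ℝ) :
    OrderSpace K → ℝ :=
  fun x => lovaszExtension (extendByZero f) x.1

end Lovasz

/-! ### Metric critical point theory -/

/-- The weak slope `|dF|(a)`: the supremum of all `ε ≥ 0` for which there are `δ > 0` and a
continuous `H : B_δ(a) × [0, δ] → M` with `F(H(x,t)) ≤ F(x) - ε t` and `dist(H(x,t), x) ≤ t`. -/
def weakSlope {M : Type*} [MetricSpace M] (F : M → ℝ) (a : M) : ℝ≥0∞ :=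
  ⨆ (ε : ℝ≥0) (_ : ∃ δ : ℝ, 0 < δ ∧ ∃ H : M × ℝ → M,
      ContinuousOn H (Metric.ball a δ ×ˢ Set.Icc 0 δ) ∧
      ∀ x ∈ Metric.ball a δ, ∀ t ∈ Set.Icc (0 : ℝ) δ,
        F (H (x, t)) ≤ F x - ε * t ∧ dist (H (x, t)) x ≤ t), (ε : ℝ≥0∞)

/-- `c` is a critical value of `F`: the value of `F` at a point of vanishing weak slope. -/
def IsMetricCriticalValue {M : Type*} [MetricSpace M] (F : M → ℝ) (c : ℝ) : Prop :=
  ∃ a : M, weakSlope F a = 0 ∧ F a = c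

end DiscreteMorseLS

end

namespace DiscreteMorseLS

/-! A point `x` of the cube lies in |S_K(L)| exactly when its superlevel sets at all heights in [0,
1) belong to `L`; its barycentric coordinate at a face is the length of the height interval on which
that face is the superlevel set. Hence F is the average of `f` with the barycentric coordinates as
weights, and every deformation below is a movement of coordinates or of weights.

Category does not decrease when a set is deformed into another (`DeformsInto.lsCat_le`). Let c =
f(σ) be the discrete minimum. Then |S_K({f ≤ c})| has category at least m, while {f < c} is not in
the discrete class. Since {F < c} deforms into |S_K({f < c})| (`deformsInto_strict_sublevel`), it is
not in the continuous class either, so no admissible set has supremum below c; |S_K({f ≤ c})| has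
supremum exactly c.

Criticality follows by contradiction. If U(σ) or L(σ) had an element, |S_K({f ≤ c})| would deform
into |S_K({f < c})| (`deformsInto_of_mem_upperSet`, `deformsInto_of_mem_lowerSet`). By injectivity,
F < c on |S_K({f ≤ c})| except at 1_σ, so a nonzero weak slope there would push this set into {F <
c} (`DeformsInto.of_weakSlope_ne_zero`). -/

theorem indicatorVector_apply {V : Type*} [DecidableEq V] (A : Finset V) (i : V) :
    indicatorVector A i = if i ∈ A then 1 else 0 := by
  simp [indicatorVector, Set.indicator_apply]

/-! ### Points of the realization described by their superlevel sets. -/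

section Levels

variable {V : Type*} [Fintype V]

/-- The strict superlevel set `{i : t < x i}`. -/
noncomputable def superlevel (x : V → ℝ) (t : ℝ) : Finset V :=
  Finset.univ.filter fun i => t < x i

@[simp] theorem mem_superlevel {x : V → ℝ} {t : ℝ} {i : V} : i ∈ superlevel x t ↔ t < x i := by
  simp [superlevel]

theorem superlevel_anti (x : V → ℝ) {s t : ℝ} (h : s ≤ t) : superlevel x t ⊆ superlevel x s := by
  intro i hi
  simp only [mem_superlevel] at *
  linarith

/-- `x` lies in the unit cube and all its superlevel sets at heights in `[0, 1)` belong to `L`. -/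
def HasLevelsIn {K : AbstractSimplicialComplex V} (L : Set K.faces) (x : V → ℝ) : Prop :=
  (∀ i, 0 ≤ x i ∧ x i ≤ 1) ∧
    ∀ t, 0 ≤ t → t < 1 → ∃ h : superlevel x t ∈ K.faces, (⟨_, h⟩ : K.faces) ∈ L

theorem HasLevelsIn.mono {K : AbstractSimplicialComplex V} {L L' : Set K.faces} (h : L ⊆ L')
    {x : V → ℝ} (hx : HasLevelsIn L x) : HasLevelsIn L' x :=
  ⟨hx.1, fun t h0 h1 => ⟨(hx.2 t h0 h1).1, h (hx.2 t h0 h1).2⟩⟩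

theorem hasLevelsIn_of_mem_realization {K : AbstractSimplicialComplex V} {L : Set K.faces}
    {x : V → ℝ} (hx : x ∈ realization (inducedSubcomplex (orderComplex K) L)) :
    HasLevelsIn L x := by
  classical
  simp only [realization, Set.mem_iUnion] at hx
  obtain ⟨C, ⟨⟨-, hchain⟩, hCL⟩, hx⟩ := hx
  rw [mem_convexHull_iff_exists_fintype] at hx
  obtain ⟨ι, _, w, z, hw0, hw1, hz, rfl⟩ := hx
  choose r hrC hr using hz
  have hcmp : ∀ i j, (r i).1 ⊆ (r j).1 ∨ (r j).1 ⊆ (r i).1 := fun i j =>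
    hchain.total (hrC i) (hrC j)
  have hval : ∀ v, (∑ i, w i • z i) v = ∑ i, if v ∈ (r i).1 then w i else 0 := by
    intro v
    simp only [Finset.sum_apply, Pi.smul_apply, ← hr, indicatorVector_apply, smul_eq_mul, mul_ite,
      mul_one, mul_zero]
  refine ⟨fun v => ?_, fun t h0 h1 => ?_⟩
  · rw [hval]
    refine ⟨Finset.sum_nonneg fun i _ => ?_, ?_⟩
    · split_ifs
      exacts [hw0 i, le_rfl]
    · rw [← hw1]
      refine Finset.sum_le_sum fun i _ => ?_
      split_ifs
      exacts [le_rfl, hw0 i]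
  -- `W i` is the value of the point at a vertex whose smallest containing member of the chain is `r
  -- i`. The level at height `t` is therefore the largest `r i` with `t < W i`.
  · set W : ι → ℝ := fun i => ∑ j, if (r i).1 ⊆ (r j).1 then w j else 0
    have hne : Nonempty ι := by
      by_contra h
      rw [not_nonempty_iff] at h
      simp at hw1
    have hT : (Finset.univ.filter fun i => t < W i).Nonempty := by
      obtain ⟨i, -, hi⟩ := Finset.exists_min_image Finset.univ (fun i => (r i).1.card)
        Finset.univ_nonempty
      refine ⟨i, ?_⟩
      have hsub : ∀ j, (r i).1 ⊆ (r j).1 := fun j => by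
        rcases hcmp i j with h | h
        · exact h
        · exact (Finset.eq_of_subset_of_card_le h (hi j (Finset.mem_univ _))).ge
      have hW : W i = 1 := by simp only [W, hsub, if_true, hw1]
      simpa [hW] using h1
    obtain ⟨i, hi, hmax⟩ := Finset.exists_max_image _ (fun i => (r i).1.card) hT
    simp only [Finset.mem_filter, Finset.mem_univ, true_and] at hi hmax
    have key : superlevel (∑ i, w i • z i) t = (r i).1 := by
      ext v
      rw [mem_superlevel, hval]
      constructor
      · intro hv
        have hS : (Finset.univ.filter fun j => v ∈ (r j).1).Nonempty := by
          by_contra h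
          rw [Finset.not_nonempty_iff_eq_empty, Finset.filter_eq_empty_iff] at h
          simp only [Finset.mem_univ, forall_const] at h
          simp only [h, if_false, Finset.sum_const_zero] at hv
          linarith
        obtain ⟨j, hj, hmin⟩ := Finset.exists_min_image _ (fun i => (r i).1.card) hS
        simp only [Finset.mem_filter, Finset.mem_univ, true_and] at hj hmin
        have hWj : t < W j := by
          refine hv.trans_le (Finset.sum_le_sum fun k _ => ?_)
          by_cases hk : v ∈ (r k).1
          · have : (r j).1 ⊆ (r k).1 := by
              rcases hcmp j k with h | h
              · exact h
              · exact (Finset.eq_of_subset_of_card_le h (hmin k hk)).ge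
            simp [hk, this]
          · simp only [hk, if_false]
            split_ifs
            exacts [hw0 k, le_rfl]
        rcases hcmp j i with h | h
        · exact h hj
        · exact (Finset.eq_of_subset_of_card_le h (hmax j hWj)).ge hj
      · intro hv
        refine hi.trans_le (Finset.sum_le_sum fun k _ => ?_)
        by_cases hk : (r i).1 ⊆ (r k).1
        · simp [hk, hk hv]
        · simp only [hk, if_false]
          split_ifs
          exacts [hw0 k, le_rfl]
    refine ⟨key ▸ (r i).2, ?_⟩
    have : (⟨_, key ▸ (r i).2⟩ : K.faces) = r i := Subtype.ext key
    rw [this]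
    exact hCL (hrC i)

theorem sum_smul_indicatorVector_mem_realization {K : AbstractSimplicialComplex V}
    {L : Set K.faces} (μ : Finset V → ℝ) (h0 : ∀ A, 0 ≤ μ A) (h1 : ∑ A, μ A = 1)
    (hL : ∀ A, μ A ≠ 0 → ∃ h : A ∈ K.faces, (⟨A, h⟩ : K.faces) ∈ L)
    (hchain : ∀ A B, μ A ≠ 0 → μ B ≠ 0 → A ⊆ B ∨ B ⊆ A) :
    ∑ A, μ A • indicatorVector A ∈ realization (inducedSubcomplex (orderComplex K) L) := by
  classical
  set C : Finset K.faces := Finset.univ.filter fun A => μ A.1 ≠ 0 with hC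
  have hCne : C.Nonempty := by
    by_contra h
    rw [Finset.not_nonempty_iff_eq_empty, Finset.filter_eq_empty_iff] at h
    have : ∑ A, μ A = 0 := Finset.sum_eq_zero fun A _ => by
      by_contra hA
      exact h (Finset.mem_univ ⟨A, (hL A hA).1⟩) hA
    linarith
  simp only [realization, Set.mem_iUnion]
  refine ⟨C, ⟨⟨hCne, ?_⟩, ?_⟩, ?_⟩
  · intro A hA B hB _
    simp only [hC, Finset.coe_filter, Finset.mem_univ, true_and, Set.mem_ofPred_eq] at hA hB
    exact hchain A.1 B.1 hA hB
  · intro A hA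
    simp only [hC, Finset.coe_filter, Finset.mem_univ, true_and, Set.mem_ofPred_eq] at hA
    exact (hL A.1 hA).2
  · rw [← Finset.sum_filter_add_sum_filter_not Finset.univ (fun A => μ A ≠ 0)] at h1 ⊢
    rw [Finset.sum_eq_zero (s := Finset.univ.filter fun A => ¬ μ A ≠ 0), add_zero] at h1 ⊢
    · refine (convex_convexHull ℝ _).sum_mem (fun A _ => h0 A) h1 fun A hA => ?_
      have hA' : μ A ≠ 0 := by simpa using hA
      refine subset_convexHull ℝ _ ⟨⟨A, (hL A hA').1⟩, ?_, rfl⟩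
      simp [hC, hA']
    · intro A hA
      simp only [Finset.mem_filter, not_not] at hA
      simp [hA.2]
    · intro A hA
      simp only [Finset.mem_filter, not_not] at hA
      exact hA.2

/-- Levels shrink with height and `K` is closed under nonempty subsets, so only the lowest level
needs checking; a coordinate equal to 1 keeps the others nonempty. -/
theorem hasLevelsIn_univ_of {K : AbstractSimplicialComplex V} {x : V → ℝ}
    (hx : ∀ i, 0 ≤ x i ∧ x i ≤ 1) (h1 : ∃ i, x i = 1) (hK : superlevel x 0 ∈ K.faces) :
    HasLevelsIn (Set.univ : Set K.faces) x := by
  refine ⟨hx, fun t h0 ht => ⟨(K.isRelLowerSet_faces hK).2 (superlevel_anti x h0) ?_, trivial⟩⟩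
  obtain ⟨i, hi⟩ := h1
  exact ⟨i, by simp [hi, ht]⟩

theorem intervalIntegrable_superlevel (g : Finset V → ℝ) (x : V → ℝ) (a b : ℝ) :
    IntervalIntegrable (fun t => g (superlevel x t)) MeasureTheory.volume a b := by
  classical
  have hm : Measurable fun t => g (superlevel x t) := by
    have : (fun t => g (superlevel x t)) =
        fun t => ∑ A, if superlevel x t = A then g A else 0 := by
      funext t
      simp
    rw [this]
    refine Finset.measurable_sum _ fun A _ => Measurable.ite ?_ measurable_const measurable_const
    have : {t | superlevel x t = A} = ⋂ i, {t | t < x i ↔ i ∈ A} := by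
      ext t
      simp [Finset.ext_iff]
    rw [this]
    refine MeasurableSet.iInter fun i => ?_
    by_cases hi : i ∈ A
    · simpa only [hi, iff_true, id] using measurableSet_lt measurable_id measurable_const
    · simpa only [hi, iff_false, not_lt, id] using measurableSet_le measurable_const measurable_id
  obtain ⟨M, hM⟩ := (Set.finite_range fun A => ‖g A‖).bddAbove
  exact (intervalIntegrable_const (c := M)).mono_fun hm.aestronglyMeasurable
    (Filter.Eventually.of_forall fun t => by
      have := hM ⟨superlevel x t, rfl⟩
      exact this.trans (le_abs_self M))

end Levels

/-! ### Barycentric coordinates as lengths of height intervals. -/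

section Barycentric

variable {V : Type*} [Fintype V] [Nonempty V]

open Classical in
/-- The smallest height `t ≥ 0` at which the superlevel set of `x` is contained in `A`. -/
noncomputable def outerMax (x : V → ℝ) (A : Finset V) : ℝ :=
  Finset.univ.sup' Finset.univ_nonempty fun i => if i ∈ A then 0 else x i

open Classical in
/-- The supremum of the heights `t < 1` at which the superlevel set of `x` contains `A`. -/
noncomputable def innerMin (x : V → ℝ) (A : Finset V) : ℝ :=
  Finset.univ.inf' Finset.univ_nonempty fun i => if i ∈ A then x i else 1

/-- The barycentric coordinate of `x` at the vertex `A` of the order complex. -/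
noncomputable def baryCoord (x : V → ℝ) (A : Finset V) : ℝ :=
  max 0 (innerMin x A - outerMax x A)

theorem continuous_outerMax (A : Finset V) : Continuous fun x : V → ℝ => outerMax x A := by
  refine Continuous.finset_sup'_apply _ fun i _ => ?_
  split_ifs <;> fun_prop

theorem continuous_innerMin (A : Finset V) : Continuous fun x : V → ℝ => innerMin x A := by
  refine Continuous.finset_inf'_apply _ fun i _ => ?_
  split_ifs <;> fun_prop

theorem continuous_baryCoord (A : Finset V) : Continuous fun x : V → ℝ => baryCoord x A :=
  continuous_const.max ((continuous_innerMin A).sub (continuous_outerMax A))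

theorem baryCoord_nonneg (x : V → ℝ) (A : Finset V) : 0 ≤ baryCoord x A := le_max_left _ _

theorem mem_Ico_iff_superlevel_eq {x : V → ℝ} (hx : ∀ i, 0 ≤ x i ∧ x i ≤ 1) (A : Finset V) (t : ℝ) :
    t ∈ Set.Ico (outerMax x A) (innerMin x A) ↔ (0 ≤ t ∧ t < 1) ∧ superlevel x t = A := by
  classical
  simp only [outerMax, innerMin, Set.mem_Ico, Finset.sup'_le_iff, Finset.lt_inf'_iff,
    Finset.mem_univ, true_imp_iff]
  constructor
  · rintro ⟨h, h'⟩
    obtain ⟨v⟩ := ‹Nonempty V›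
    have hv := h v
    have hv' := h' v
    refine ⟨⟨?_, ?_⟩, ?_⟩
    · split_ifs at hv
      exacts [hv, (hx v).1.trans hv]
    · split_ifs at hv'
      exacts [hv'.trans_le (hx v).2, hv']
    · ext i
      have := h i
      have := h' i
      rw [mem_superlevel]
      by_cases hi : i ∈ A
      · simp_all
      · simp_all
  · rintro ⟨⟨h0, h1⟩, rfl⟩
    refine ⟨fun i => ?_, fun i => ?_⟩
    · split_ifs with hi
      · exact h0
      · simpa using hi
    · split_ifs with hi
      · simpa using hi
      · exact h1

theorem exists_superlevel_eq {x : V → ℝ} (hx : ∀ i, 0 ≤ x i ∧ x i ≤ 1) {A : Finset V}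
    (hA : baryCoord x A ≠ 0) : ∃ t, 0 ≤ t ∧ t < 1 ∧ superlevel x t = A := by
  have h : outerMax x A < innerMin x A := by
    by_contra h
    exact hA (max_eq_left (by linarith))
  have := (mem_Ico_iff_superlevel_eq hx A (outerMax x A)).1 ⟨le_rfl, h⟩
  exact ⟨_, this.1.1, this.1.2, this.2⟩

theorem baryCoord_chain {x : V → ℝ} (hx : ∀ i, 0 ≤ x i ∧ x i ≤ 1) (A B : Finset V)
    (hA : baryCoord x A ≠ 0) (hB : baryCoord x B ≠ 0) : A ⊆ B ∨ B ⊆ A := by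
  obtain ⟨s, -, -, rfl⟩ := exists_superlevel_eq hx hA
  obtain ⟨t, -, -, rfl⟩ := exists_superlevel_eq hx hB
  rcases le_total s t with h | h
  · exact Or.inr (superlevel_anti x h)
  · exact Or.inl (superlevel_anti x h)

/-- The integrand is a step function, equal to `g A` on an interval of length `baryCoord x A`.
Taking `g` to be 1, the coordinates of indicator vectors, or `f` gives the total mass, the
reconstruction of `x`, and the formula for F. -/
theorem integral_superlevel {x : V → ℝ} (hx : ∀ i, 0 ≤ x i ∧ x i ≤ 1) (g : Finset V → ℝ) :
    ∫ t in (0 : ℝ)..1, g (superlevel x t) = ∑ A, baryCoord x A * g A := by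
  classical
  have h1 : ∀ t ∈ Set.Ico (0 : ℝ) 1, g (superlevel x t) =
      ∑ A, (Set.Ico (outerMax x A) (innerMin x A)).indicator (fun _ => g A) t := by
    intro t ht
    have : ∀ A, (Set.Ico (outerMax x A) (innerMin x A)).indicator (fun _ => g A) t =
        if superlevel x t = A then g A else 0 := by
      intro A
      rw [Set.indicator_apply]
      refine if_congr ?_ rfl rfl
      rw [mem_Ico_iff_superlevel_eq hx]
      exact ⟨fun h => h.2, fun h => ⟨ht, h⟩⟩
    simp [this]
  rw [intervalIntegral.integral_of_le zero_le_one, ← MeasureTheory.integral_Ico_eq_integral_Ioc,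
    MeasureTheory.setIntegral_congr_fun measurableSet_Ico h1,
    MeasureTheory.integral_finsetSum]
  · refine Finset.sum_congr rfl fun A _ => ?_
    rw [MeasureTheory.setIntegral_indicator measurableSet_Ico]
    have : Set.Ico (0 : ℝ) 1 ∩ Set.Ico (outerMax x A) (innerMin x A) =
        Set.Ico (outerMax x A) (innerMin x A) := by
      refine Set.inter_eq_right.2 fun t ht => ?_
      exact ((mem_Ico_iff_superlevel_eq hx A t).1 ht).1
    rw [this, MeasureTheory.setIntegral_const, smul_eq_mul, Real.volume_real_Ico, baryCoord,
      max_comm]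
  · intro A _
    refine (MeasureTheory.integrable_const (g A)).indicator measurableSet_Ico

theorem sum_baryCoord {x : V → ℝ} (hx : ∀ i, 0 ≤ x i ∧ x i ≤ 1) : ∑ A, baryCoord x A = 1 := by
  simpa using (integral_superlevel hx fun _ => 1).symm

theorem sum_baryCoord_smul {x : V → ℝ} (hx : ∀ i, 0 ≤ x i ∧ x i ≤ 1) :
    ∑ A, baryCoord x A • indicatorVector A = x := by
  classical
  funext i
  rw [Finset.sum_apply]
  simp only [Pi.smul_apply, smul_eq_mul]
  rw [← integral_superlevel hx fun A => indicatorVector A i,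
    ← intervalIntegral.integral_add_adjacent_intervals
      (intervalIntegrable_superlevel (fun A => indicatorVector A i) x 0 (x i))
      (intervalIntegrable_superlevel (fun A => indicatorVector A i) x (x i) 1)]
  rw [intervalIntegral.integral_congr_ae (g := fun _ => 1),
    intervalIntegral.integral_congr (a := x i) (g := fun _ => 0)]
  · simp
  · intro t ht
    rw [Set.uIcc_of_le (hx i).2] at ht
    simp [indicatorVector_apply, ht.1]
  · have : ∀ᵐ t : ℝ, t ≠ x i := by
      simp [MeasureTheory.ae_iff, MeasureTheory.measure_singleton]
    filter_upwards [this] with t hne ht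
    rw [Set.uIoc_of_le (hx i).1] at ht
    simp [indicatorVector_apply, lt_of_le_of_ne ht.2 hne]

theorem mem_realization_iff {K : AbstractSimplicialComplex V} {L : Set K.faces} {x : V → ℝ} :
    x ∈ realization (inducedSubcomplex (orderComplex K) L) ↔ HasLevelsIn L x := by
  refine ⟨hasLevelsIn_of_mem_realization, fun hx => ?_⟩
  rw [← sum_baryCoord_smul hx.1]
  refine sum_smul_indicatorVector_mem_realization _ (baryCoord_nonneg x) (sum_baryCoord hx.1)
    (fun A hA => ?_) (baryCoord_chain hx.1)
  obtain ⟨t, h0, h1, rfl⟩ := exists_superlevel_eq hx.1 hA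
  exact hx.2 t h0 h1

theorem mem_realization_orderComplex_iff {K : AbstractSimplicialComplex V} {x : V → ℝ} :
    x ∈ realization (orderComplex K).toPreAbstractSimplicialComplex ↔
      HasLevelsIn (Set.univ : Set K.faces) x := by
  rw [← mem_realization_iff]
  simp [realization, inducedSubcomplex]

theorem mem_orderSubspace {K : AbstractSimplicialComplex V} {L : Set K.faces} {x : OrderSpace K} :
    x ∈ orderSubspace K L ↔ HasLevelsIn L x.1 :=
  mem_realization_iff

theorem OrderSpace.hasLevelsIn {K : AbstractSimplicialComplex V} (x : OrderSpace K) :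
    HasLevelsIn (Set.univ : Set K.faces) x.1 :=
  mem_realization_orderComplex_iff.1 x.2

theorem HasLevelsIn.exists_eq_one {K : AbstractSimplicialComplex V} {L : Set K.faces} {x : V → ℝ}
    (hx : HasLevelsIn L x) : ∃ i, x i = 1 := by
  obtain ⟨i, hi⟩ := Finite.exists_max x
  refine ⟨i, le_antisymm (hx.1 i).2 ?_⟩
  by_contra! h
  obtain ⟨hK, -⟩ := hx.2 (x i) (hx.1 i).1 h
  obtain ⟨j, hj⟩ := (K.isRelLowerSet_faces hK).1
  rw [mem_superlevel] at hj
  exact absurd (hi j) (not_le.2 hj)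

/-- On |S_K| the maximum of `x` is 1, and below the minimum the level is all of V, so the term `f(V)
min x` is the missing piece of the integral over [0, 1]. -/
theorem lovaszOnOrderSpace_eq {K : AbstractSimplicialComplex V} (f : K.faces → ℝ)
    (x : OrderSpace K) :
    lovaszOnOrderSpace f x = ∑ A, baryCoord x.1 A * extendByZero f A := by
  have hx := x.hasLevelsIn
  rw [← integral_superlevel hx.1, lovaszOnOrderSpace, lovaszExtension]
  have hmax : ⨆ i, x.1 i = 1 := by
    obtain ⟨i, hi⟩ := hx.exists_eq_one
    exact le_antisymm (ciSup_le fun j => (hx.1 j).2)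
      (hi ▸ le_ciSup (Set.finite_range x.1).bddAbove i)
  have hmin : 0 ≤ ⨅ i, x.1 i := le_ciInf fun i => (hx.1 i).1
  rw [hmax, ← intervalIntegral.integral_add_adjacent_intervals
      (intervalIntegrable_superlevel (extendByZero f) x.1 0 (⨅ i, x.1 i))
      (intervalIntegrable_superlevel (extendByZero f) x.1 (⨅ i, x.1 i) 1), add_comm]
  congr 1
  rw [intervalIntegral.integral_congr_ae (g := fun _ => extendByZero f Finset.univ)]
  · simp [mul_comm]
  · have : ∀ᵐ t : ℝ, t ≠ ⨅ i, x.1 i := by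
      simp [MeasureTheory.ae_iff, MeasureTheory.measure_singleton]
    filter_upwards [this] with t hne ht
    rw [Set.uIoc_of_le hmin] at ht
    congr 1
    ext i
    simpa using (lt_of_le_of_ne ht.2 hne).trans_le (ciInf_le (Set.finite_range x.1).bddBelow i)

end Barycentric

/-! ### Deformations, category and the weak slope. -/

section Deformation

variable {X : Type*} [TopologicalSpace X]

/-- `S` can be deformed within `X` into `T`. -/
def DeformsInto (S T : Set X) : Prop :=
  ∃ φ : S × unitInterval → X, Continuous φ ∧ (∀ x, φ (x, 0) = x.1) ∧ ∀ x, φ (x, 1) ∈ T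

theorem DeformsInto.of_subset {S T : Set X} (h : S ⊆ T) : DeformsInto S T :=
  ⟨fun p => p.1.1, by fun_prop, fun _ => rfl, fun x => h x.2⟩

theorem DeformsInto.nonempty {S T : Set X} (h : DeformsInto S T) (hS : S.Nonempty) :
    T.Nonempty := by
  obtain ⟨φ, -, -, h1⟩ := h
  obtain ⟨x, hx⟩ := hS
  exact ⟨_, h1 ⟨x, hx⟩⟩

/-- Pull a cover of `T` back along the end map. On each piece the inclusion is homotopic to a map
through `U i`, hence null-homotopic. -/
theorem DeformsInto.lsCat_le {S T : Set X} (h : DeformsInto S T) : lsCat S ≤ lsCat T := by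
  obtain ⟨φ, hφ, h0, h1⟩ := h
  refine le_iInf₂ fun k => ?_
  rintro ⟨U, hU, hTU⟩
  refine iInf₂_le k ⟨fun i => {x | ∃ h : x ∈ S, φ (⟨x, h⟩, 1) ∈ U i}, fun i => ?_, fun x hx => ?_⟩
  · set U' : Set X := {x | ∃ h : x ∈ S, φ (⟨x, h⟩, 1) ∈ U i}
    let j : C(U', S) := ⟨fun x => ⟨x.1, x.2.1⟩, by fun_prop⟩
    let g : C(U', U i) := ⟨fun x => ⟨φ (j x, 1), x.2.2⟩, by fun_prop⟩
    have hhom : (⟨Subtype.val, continuous_subtype_val⟩ : C(U', X)).Homotopic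
        ((⟨Subtype.val, continuous_subtype_val⟩ : C(U i, X)).comp g) :=
      ⟨{ toFun := fun p => φ (j p.2, p.1)
         continuous_toFun := by fun_prop
         map_zero_left := fun x => h0 (j x)
         map_one_left := fun x => rfl }⟩
    obtain ⟨y, hy⟩ := hU i
    exact ⟨y, hhom.trans (hy.comp (ContinuousMap.Homotopic.refl g))⟩
  · obtain ⟨i, hi⟩ := Set.mem_iUnion.1 (hTU (h1 ⟨x, hx⟩))
    exact Set.mem_iUnion.2 ⟨i, hx, hi⟩

/-- Run the local descent `H` for a time that vanishes away from `a` and extend by the identity. The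
distance bound at time 0 gives `H (x, 0) = x`, which makes the pieces match. -/
theorem DeformsInto.of_weakSlope_ne_zero {M : Type*} [MetricSpace M] {F : M → ℝ} {a : M}
    (h : weakSlope F a ≠ 0) {S : Set M} (hS : ∀ x ∈ S, x ≠ a → F x < F a) :
    DeformsInto S {x | F x < F a} := by
  obtain ⟨ε, hε, δ, hδ, H, hH, hHF⟩ : ∃ ε : ℝ≥0, 0 < ε ∧ ∃ δ : ℝ, 0 < δ ∧ ∃ H : M × ℝ → M,
      ContinuousOn H (Metric.ball a δ ×ˢ Set.Icc 0 δ) ∧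
      ∀ x ∈ Metric.ball a δ, ∀ t ∈ Set.Icc (0 : ℝ) δ,
        F (H (x, t)) ≤ F x - ε * t ∧ dist (H (x, t)) x ≤ t := by
    by_contra! hcon
    refine h (le_antisymm (iSup₂_le ?_) (zero_le (a := weakSlope F a)))
    rintro ε ⟨δ, hδ, H, hH, hHF⟩
    rcases (zero_le (a := ε)).eq_or_lt with h0 | h0
    · simp [← h0]
    · obtain ⟨x, hx, t, ht, h2⟩ := hcon ε h0 δ hδ H hH
      exact absurd (hHF x hx t ht).2 (not_le.2 (h2 (hHF x hx t ht).1))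
  classical
  -- The cutoff already vanishes at distance δ/2, leaving an annulus inside the ball on which the
  -- two formulas for `G` agree.
  set τ : M → ℝ := fun x => max 0 (δ / 2 - dist x a) with hτ
  have hτ0 : ∀ x, 0 ≤ τ x := fun x => le_max_left _ _
  have hτδ : ∀ x, τ x ≤ δ := fun x => max_le hδ.le (by linarith [dist_nonneg (x := x) (y := a)])
  have hτc : Continuous τ := by fun_prop
  have hst : ∀ (x : M) (s : unitInterval), s.1 * τ x ∈ Set.Icc 0 δ := fun x s =>
    ⟨mul_nonneg s.2.1 (hτ0 x), (mul_le_of_le_one_left (hτ0 x) s.2.2).trans (hτδ x)⟩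
  have hfix : ∀ x ∈ Metric.ball a δ, H (x, 0) = x := fun x hx =>
    dist_le_zero.1 (hHF x hx 0 ⟨le_rfl, hδ.le⟩).2
  set G : M × unitInterval → M := fun p =>
    if dist p.1 a < δ then H (p.1, p.2.1 * τ p.1) else p.1 with hG
  have hfar : ∀ p : M × unitInterval, δ / 2 ≤ dist p.1 a → G p = p.1 := by
    intro p hp
    simp only [hG]
    split_ifs with hd
    · have : τ p.1 = 0 := max_eq_left (by linarith)
      rw [this, mul_zero]
      exact hfix _ hd
    · rfl
  have hGc : Continuous G := by
    rw [continuous_iff_continuousAt]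
    intro p
    rcases lt_or_ge (dist p.1 a) δ with hp | hp
    · have hopen : IsOpen {q : M × unitInterval | dist q.1 a < δ} :=
        isOpen_lt (by fun_prop) continuous_const
      have hon : ContinuousOn G {q : M × unitInterval | dist q.1 a < δ} := by
        have : ContinuousOn (fun q : M × unitInterval => H (q.1, q.2.1 * τ q.1))
            {q : M × unitInterval | dist q.1 a < δ} :=
          hH.comp (f := fun q : M × unitInterval => (q.1, q.2.1 * τ q.1))
            (by fun_prop) fun q hq => ⟨hq, hst q.1 q.2⟩
        refine this.congr fun q hq => ?_
        exact if_pos hq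
      exact hon.continuousAt (hopen.mem_nhds hp)
    · have hopen : IsOpen {q : M × unitInterval | δ / 2 < dist q.1 a} :=
        isOpen_lt continuous_const (by fun_prop)
      have hmem : p ∈ {q : M × unitInterval | δ / 2 < dist q.1 a} := by
        show δ / 2 < dist p.1 a
        linarith
      have hev : G =ᶠ[nhds p] fun q => q.1 := by
        filter_upwards [hopen.mem_nhds hmem] with q hq using hfar q (le_of_lt hq)
      exact continuous_fst.continuousAt.congr hev.symm
  refine ⟨fun p => G (p.1.1, p.2), by fun_prop, fun x => ?_, fun x => ?_⟩
  · simp only [hG]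
    split_ifs with hd
    · simpa using hfix _ hd
    · rfl
  · show F (G (x.1, 1)) < F a
    rcases lt_or_ge (dist x.1 a) (δ / 2) with hd | hd
    · have hb : dist x.1 a < δ := by linarith
      have hpos : 0 < τ x.1 := lt_max_of_lt_right (by linarith)
      have h1 := (hHF x.1 hb _ (hst x.1 1)).1
      have h2 : F x.1 ≤ F a := by
        by_cases hxa : x.1 = a
        · rw [hxa]
        · exact (hS x.1 x.2 hxa).le
      have h3 : 0 < (ε : ℝ) * τ x.1 := mul_pos hε hpos
      simp only [hG, hb, if_true]
      simp only [Set.Icc.coe_one, one_mul] at h1 ⊢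
      linarith
    · rw [hfar (x.1, 1) hd]
      refine hS x.1 x.2 fun hxa => ?_
      rw [hxa, dist_self] at hd
      linarith

end Deformation

/-! ### Discrete Morse inequalities across several dimensions. -/

section Morse

variable {V : Type*} {K : AbstractSimplicialComplex V} {f : K.faces → ℝ}

theorem face_of_subset {σ : Finset V} (ρ : K.faces) (h : σ ⊆ ρ.1) (hne : σ.Nonempty) :
    σ ∈ K.faces :=
  (K.isRelLowerSet_faces ρ.2).2 h hne

/-- In codimension at least two, `ρ` has two facets containing `σ`. They cannot both lie in
`lowerSet f ρ`, so `f` does not increase on passing to one of them; induct downwards. -/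
theorem IsDiscreteMorse.exists_coface_le (hf : IsDiscreteMorse f) {σ ρ : K.faces}
    (h : σ.1 ⊂ ρ.1) :
    ∃ τ : K.faces, σ.1 ⊆ τ.1 ∧ τ.1.card = σ.1.card + 1 ∧ τ.1 ⊆ ρ.1 ∧ f τ ≤ f ρ := by
  classical
  induction hn : ρ.1.card using Nat.strong_induction_on generalizing ρ with
  | _ n ih =>
    have hlt := Finset.card_lt_card h
    by_cases hcard : ρ.1.card = σ.1.card + 1
    · exact ⟨ρ, h.1, hcard, subset_rfl, le_rfl⟩
    · have h2 : 1 < (ρ.1 \ σ.1).card := by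
        rw [Finset.card_sdiff_of_subset h.1]
        omega
      obtain ⟨a, ha, b, hb, hab⟩ := Finset.one_lt_card.1 h2
      rw [Finset.mem_sdiff] at ha hb
      have hσne := (K.isRelLowerSet_faces σ.2).1
      have hsub : ∀ c, c ∉ σ.1 → σ.1 ⊆ ρ.1.erase c := fun c hc =>
        Finset.subset_erase.2 ⟨h.1, hc⟩
      have hK : ∀ c, c ∉ σ.1 → ρ.1.erase c ∈ K.faces := fun c hc =>
        face_of_subset ρ (Finset.erase_subset _ _) (hσne.mono (hsub c hc))
      have hstep : ∀ c (hc : c ∉ σ.1), c ∈ ρ.1 → f ⟨_, hK c hc⟩ ≤ f ρ → ∃ τ : K.faces,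
          σ.1 ⊆ τ.1 ∧ τ.1.card = σ.1.card + 1 ∧ τ.1 ⊆ ρ.1 ∧ f τ ≤ f ρ := by
        intro c hc hcρ hle
        have hce := Finset.card_erase_of_mem hcρ
        have hss : σ.1 ⊂ ρ.1.erase c :=
          (hsub c hc).ssubset_of_ne fun he => by
            rw [he] at hcard hlt
            omega
        obtain ⟨τ, h1, h2, h3, h4⟩ := ih (ρ.1.erase c).card (by omega) (ρ := ⟨_, hK c hc⟩) hss rfl
        exact ⟨τ, h1, h2, h3.trans (Finset.erase_subset _ _), h4.trans hle⟩
      rcases le_total (f ⟨_, hK a ha.2⟩) (f ρ) with h1 | h1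
      · exact hstep a ha.2 ha.1 h1
      rcases le_total (f ⟨_, hK b hb.2⟩) (f ρ) with h1' | h1'
      · exact hstep b hb.2 hb.1 h1'
      have hmem : ∀ c (hc : c ∉ σ.1), c ∈ ρ.1 → f ρ ≤ f ⟨_, hK c hc⟩ →
          (⟨_, hK c hc⟩ : K.faces) ∈ lowerSet f ρ := fun c hc hcρ hle =>
        ⟨Finset.erase_subset _ _, Finset.card_erase_add_one hcρ, hle⟩
      have heq := Set.encard_le_one_iff.1 (hf ρ).2 _ _ (hmem a ha.2 ha.1 h1) (hmem b hb.2 hb.1 h1')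
      exact absurd (Finset.erase_injOn _ ha.1 hb.1 (congrArg Subtype.val heq)) hab

/-- Dual argument: two faces `insert a ρ` and `insert b ρ` inside `σ` cannot both lie in `upperSet f
ρ`. -/
theorem IsDiscreteMorse.exists_facet_ge (hf : IsDiscreteMorse f) {ρ σ : K.faces}
    (h : ρ.1 ⊂ σ.1) :
    ∃ ν : K.faces, ρ.1 ⊆ ν.1 ∧ ν.1.card + 1 = σ.1.card ∧ ν.1 ⊆ σ.1 ∧ f ρ ≤ f ν := by
  classical
  induction hn : σ.1.card - ρ.1.card using Nat.strong_induction_on generalizing ρ with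
  | _ n ih =>
    have hlt := Finset.card_lt_card h
    by_cases hcard : ρ.1.card + 1 = σ.1.card
    · exact ⟨ρ, subset_rfl, hcard, h.1, le_rfl⟩
    · have h2 : 1 < (σ.1 \ ρ.1).card := by
        rw [Finset.card_sdiff_of_subset h.1]
        omega
      obtain ⟨a, ha, b, hb, hab⟩ := Finset.one_lt_card.1 h2
      rw [Finset.mem_sdiff] at ha hb
      have hsub : ∀ c, c ∈ σ.1 → insert c ρ.1 ⊆ σ.1 := fun c hc =>
        Finset.insert_subset hc h.1
      have hK : ∀ c, c ∈ σ.1 → insert c ρ.1 ∈ K.faces := fun c hc =>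
        face_of_subset σ (hsub c hc) (Finset.insert_nonempty _ _)
      have hstep : ∀ c (hc : c ∈ σ.1), c ∉ ρ.1 → f ρ ≤ f ⟨_, hK c hc⟩ → ∃ ν : K.faces,
          ρ.1 ⊆ ν.1 ∧ ν.1.card + 1 = σ.1.card ∧ ν.1 ⊆ σ.1 ∧ f ρ ≤ f ν := by
        intro c hc hcρ hle
        have hce := Finset.card_insert_of_notMem hcρ
        have hss : insert c ρ.1 ⊂ σ.1 :=
          (hsub c hc).ssubset_of_ne fun he => by
            rw [he] at hce
            omega
        obtain ⟨ν, h1, h2, h3, h4⟩ := ih (σ.1.card - (insert c ρ.1).card) (by omega)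
          (ρ := ⟨_, hK c hc⟩) hss rfl
        exact ⟨ν, (Finset.subset_insert _ _).trans h1, h2, h3, hle.trans h4⟩
      rcases le_total (f ρ) (f ⟨_, hK a ha.1⟩) with h1 | h1
      · exact hstep a ha.1 ha.2 h1
      rcases le_total (f ρ) (f ⟨_, hK b hb.1⟩) with h1' | h1'
      · exact hstep b hb.1 hb.2 h1'
      have hmem : ∀ c (hc : c ∈ σ.1), c ∉ ρ.1 → f ⟨_, hK c hc⟩ ≤ f ρ →
          (⟨_, hK c hc⟩ : K.faces) ∈ upperSet f ρ := fun c hc hcρ hle =>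
        ⟨Finset.subset_insert _ _, Finset.card_insert_of_notMem hcρ, hle⟩
      have heq := Set.encard_le_one_iff.1 (hf ρ).1 _ _ (hmem a ha.1 ha.2 h1) (hmem b hb.1 hb.2 h1')
      exact absurd ((Finset.insert_inj ha.2).1 (congrArg Subtype.val heq)) hab

/-- The coface from `exists_coface_le` lies in `upperSet f σ`, so it is `τ` by uniqueness. -/
theorem IsDiscreteMorse.subset_of_mem_upperSet (hf : IsDiscreteMorse f) {σ τ ρ : K.faces}
    (hτ : τ ∈ upperSet f σ) (h : σ.1 ⊂ ρ.1) (hρ : f ρ ≤ f σ) : τ.1 ⊆ ρ.1 := by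
  obtain ⟨τ', h1, h2, h3, h4⟩ := hf.exists_coface_le h
  rw [Set.encard_le_one_iff.1 (hf σ).1 _ _ hτ ⟨h1, h2, h4.trans hρ⟩]
  exact h3

theorem IsDiscreteMorse.subset_of_mem_lowerSet (hf : IsDiscreteMorse f) {σ ν ρ : K.faces}
    (hν : ν ∈ lowerSet f σ) (h : ρ.1 ⊂ σ.1) (hρ : f σ ≤ f ρ) : ρ.1 ⊆ ν.1 := by
  obtain ⟨ν', h1, h2, h3, h4⟩ := hf.exists_facet_ge h
  rw [Set.encard_le_one_iff.1 (hf σ).2 _ _ hν ⟨h3, h2, hρ.trans h4⟩]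
  exact h1

end Morse

/-! ### Values of F at vertices and sublevel sets. -/

theorem superlevel_indicatorVector {V : Type*} [Fintype V] (A : Finset V) {t : ℝ} (h0 : 0 ≤ t) (h1 : t < 1) :
    superlevel (indicatorVector A) t = A := by
  classical
  ext i
  rw [mem_superlevel, indicatorVector_apply]
  split_ifs with hi
  · simp [hi, h1]
  · simp [hi, h0]

theorem extendByZero_coe {V : Type*} {K : AbstractSimplicialComplex V} {f : K.faces → ℝ}
    (σ : K.faces) : extendByZero f σ.1 = f σ := by
  simp [extendByZero, σ.2]

theorem hasLevelsIn_indicatorVector {V : Type*} [Fintype V] {K : AbstractSimplicialComplex V}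
    {L : Set K.faces} {σ : K.faces} (h : σ ∈ L) :
    HasLevelsIn L (indicatorVector σ.1) := by
  classical
  refine ⟨fun i => ?_, fun t h0 h1 => ?_⟩
  · rw [indicatorVector_apply]
    split_ifs <;> simp
  · rw [superlevel_indicatorVector _ h0 h1]
    exact ⟨σ.2, h⟩

section OrderSpace

variable {V : Type*} [Fintype V] [Nonempty V] {K : AbstractSimplicialComplex V} {f : K.faces → ℝ}

theorem deformsInto_orderSubspace {S : Set (OrderSpace K)} {L : Set K.faces}
    (Φ : S → ℝ → V → ℝ) (hc : Continuous fun p : S × unitInterval => Φ p.1 p.2)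
    (hΦ : ∀ x, ∀ s ∈ Set.Icc (0 : ℝ) 1, HasLevelsIn (Set.univ : Set K.faces) (Φ x s))
    (h0 : ∀ x, Φ x 0 = x.1.1) (h1 : ∀ x, HasLevelsIn L (Φ x 1)) :
    DeformsInto S (orderSubspace K L) :=
  ⟨fun p => ⟨Φ p.1 p.2, mem_realization_orderComplex_iff.2 (hΦ p.1 p.2 p.2.2)⟩,
    hc.subtype_mk _, fun x => Subtype.ext (h0 x), fun x => mem_orderSubspace.2 (h1 x)⟩

theorem orderSubspace_mono {L L' : Set K.faces} (h : L ⊆ L') :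
    orderSubspace K L ⊆ orderSubspace K L' := fun _ hx =>
  mem_orderSubspace.2 ((mem_orderSubspace.1 hx).mono h)

theorem orderSubspace_univ : orderSubspace K Set.univ = Set.univ :=
  Set.eq_univ_of_forall fun x => mem_orderSubspace.2 x.hasLevelsIn

theorem nonempty_of_orderSubspace_nonempty {L : Set K.faces} (h : (orderSubspace K L).Nonempty) :
    L.Nonempty := by
  obtain ⟨x, hx⟩ := h
  obtain ⟨hK, hL⟩ := (mem_orderSubspace.1 hx).2 0 le_rfl one_pos
  exact ⟨⟨_, hK⟩, hL⟩

/-- The point `1_σ` of `|S_K|`. -/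
noncomputable def vertexPoint (σ : K.faces) : OrderSpace K :=
  ⟨indicatorVector σ.1,
    mem_realization_orderComplex_iff.2 (hasLevelsIn_indicatorVector (Set.mem_univ σ))⟩

theorem exists_mem_of_baryCoord_ne_zero {L : Set K.faces} {x : V → ℝ} (hx : HasLevelsIn L x)
    {A : Finset V} (hA : baryCoord x A ≠ 0) : ∃ ρ ∈ L, ρ.1 = A := by
  obtain ⟨t, h0, h1, rfl⟩ := exists_superlevel_eq hx.1 hA
  exact ⟨_, (hx.2 t h0 h1).2, rfl⟩

theorem lovaszOnOrderSpace_vertexPoint (σ : K.faces) :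
    lovaszOnOrderSpace f (vertexPoint σ) = f σ := by
  have h : HasLevelsIn ({σ} : Set K.faces) (vertexPoint σ).1 :=
    hasLevelsIn_indicatorVector (Set.mem_singleton σ)
  have hterm : ∀ A, baryCoord (vertexPoint σ).1 A * extendByZero f A =
      baryCoord (vertexPoint σ).1 A * f σ := by
    intro A
    by_cases hA : baryCoord (vertexPoint σ).1 A = 0
    · simp [hA]
    · obtain ⟨ρ, hρ, rfl⟩ := exists_mem_of_baryCoord_ne_zero h hA
      rw [Set.mem_singleton_iff.1 hρ, extendByZero_coe]
  rw [lovaszOnOrderSpace_eq]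
  simp_rw [hterm]
  rw [← Finset.sum_mul, sum_baryCoord h.1, one_mul]

theorem baryCoord_mul_le {L : Set K.faces} {c : ℝ} (hL : ∀ ρ ∈ L, f ρ ≤ c) {x : V → ℝ}
    (hx : HasLevelsIn L x) (A : Finset V) :
    baryCoord x A * extendByZero f A ≤ baryCoord x A * c := by
  by_cases hA : baryCoord x A = 0
  · simp [hA]
  · obtain ⟨ρ, hρ, rfl⟩ := exists_mem_of_baryCoord_ne_zero hx hA
    rw [extendByZero_coe]
    exact mul_le_mul_of_nonneg_left (hL ρ hρ) (baryCoord_nonneg _ _)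

theorem lovaszOnOrderSpace_le {L : Set K.faces} {c : ℝ} (hL : ∀ ρ ∈ L, f ρ ≤ c) {x : OrderSpace K}
    (hx : x ∈ orderSubspace K L) : lovaszOnOrderSpace f x ≤ c := by
  have h := mem_orderSubspace.1 hx
  calc lovaszOnOrderSpace f x = ∑ A, baryCoord x.1 A * extendByZero f A :=
        lovaszOnOrderSpace_eq f x
    _ ≤ ∑ A, baryCoord x.1 A * c := Finset.sum_le_sum fun A _ => baryCoord_mul_le hL h A
    _ = c := by rw [← Finset.sum_mul, sum_baryCoord h.1, one_mul]

/-- An average of values at most `f σ` equals `f σ` only if all weight sits where `f = f σ`, and by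
injectivity that is the single vertex `σ`. -/
theorem lovaszOnOrderSpace_lt (hinj : Function.Injective f) {σ : K.faces} {x : OrderSpace K}
    (hx : x ∈ orderSubspace K {ρ | f ρ ≤ f σ}) (hne : x ≠ vertexPoint σ) :
    lovaszOnOrderSpace f x < f σ := by
  refine lt_of_le_of_ne (lovaszOnOrderSpace_le (fun _ h => h) hx) fun heq => hne ?_
  have h := mem_orderSubspace.1 hx
  have hsum : ∑ A, baryCoord x.1 A * extendByZero f A = ∑ A, baryCoord x.1 A * f σ := by
    rw [← lovaszOnOrderSpace_eq, heq, ← Finset.sum_mul, sum_baryCoord h.1, one_mul]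
  have hterm := (Finset.sum_eq_sum_iff_of_le fun A _ => baryCoord_mul_le (fun _ h => h) h A).1 hsum
  have hzero : ∀ A, A ≠ σ.1 → baryCoord x.1 A = 0 := by
    intro A hA
    by_contra h0
    have h2 := mul_left_cancel₀ h0 (hterm A (Finset.mem_univ _))
    obtain ⟨ρ, -, rfl⟩ := exists_mem_of_baryCoord_ne_zero h h0
    rw [extendByZero_coe] at h2
    exact hA (congrArg Subtype.val (hinj h2))
  have hone : baryCoord x.1 σ.1 = 1 := by
    rw [← sum_baryCoord h.1]
    exact (Finset.sum_eq_single σ.1 (fun A _ hA => hzero A hA) (by simp)).symm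
  refine Subtype.ext ?_
  rw [← sum_baryCoord_smul h.1, Finset.sum_eq_single σ.1 (fun A _ hA => by simp [hzero A hA])
    (by simp), hone, one_smul]
  rfl

/-- Discard the weights on faces with `f ≥ c`, renormalize, and move there along a segment. The
support never grows, so the point stays in its simplex. -/
theorem deformsInto_strict_sublevel (f : K.faces → ℝ) (c : ℝ) :
    DeformsInto {x : OrderSpace K | lovaszOnOrderSpace f x < c} (orderSubspace K {ρ | f ρ < c}) := by
  classical
  set P : Finset V → Prop := fun A => ∃ h : A ∈ K.faces, f ⟨A, h⟩ < c
  set μ : (V → ℝ) → Finset V → ℝ := fun x A => if P A then baryCoord x A else 0 with hμ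
  have hμ0 : ∀ x A, 0 ≤ μ x A := by
    intro x A
    simp only [hμ]
    split_ifs
    exacts [baryCoord_nonneg _ _, le_rfl]
  have hμne : ∀ x A, μ x A ≠ 0 → P A ∧ baryCoord x A ≠ 0 := by
    intro x A h
    simp only [hμ] at h
    split_ifs at h with hP
    exacts [⟨hP, h⟩, (h rfl).elim]
  have hμc : ∀ A, Continuous fun x => μ x A := by
    intro A
    simp only [hμ]
    split_ifs
    exacts [continuous_baryCoord A, continuous_const]
  -- If no weight lay on {f < c}, F would average values at least `c`.
  have hD : ∀ x : OrderSpace K, lovaszOnOrderSpace f x < c → 0 < ∑ A, μ x.1 A := by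
    intro x hx
    by_contra hle
    have h0 : ∑ A, μ x.1 A = 0 := le_antisymm (not_lt.1 hle) (Finset.sum_nonneg fun A _ => hμ0 _ A)
    rw [Finset.sum_eq_zero_iff_of_nonneg fun A _ => hμ0 _ A] at h0
    refine not_le.2 hx ?_
    calc c = ∑ A, baryCoord x.1 A * c := by
          rw [← Finset.sum_mul, sum_baryCoord x.hasLevelsIn.1, one_mul]
      _ ≤ ∑ A, baryCoord x.1 A * extendByZero f A := by
          refine Finset.sum_le_sum fun A _ => ?_
          by_cases hA : baryCoord x.1 A = 0
          · simp [hA]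
          · obtain ⟨ρ, -, rfl⟩ := exists_mem_of_baryCoord_ne_zero x.hasLevelsIn hA
            rw [extendByZero_coe]
            refine mul_le_mul_of_nonneg_left ?_ (baryCoord_nonneg _ _)
            by_contra hlt
            have hP : P ρ.1 := ⟨ρ.2, not_le.1 hlt⟩
            have := h0 ρ.1 (Finset.mem_univ _)
            simp only [hμ, hP, if_true] at this
            exact hA this
      _ = lovaszOnOrderSpace f x := (lovaszOnOrderSpace_eq f x).symm
  set w : (V → ℝ) → ℝ → Finset V → ℝ := fun x s A =>
    (1 - s) * baryCoord x A + s * (μ x A / ∑ B, μ x B) with hw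
  have hw0 : ∀ x : OrderSpace K, lovaszOnOrderSpace f x < c → ∀ s ∈ Set.Icc (0 : ℝ) 1, ∀ A,
      0 ≤ w x.1 s A := fun x hx s hs A =>
    add_nonneg (mul_nonneg (sub_nonneg.2 hs.2) (baryCoord_nonneg _ _))
      (mul_nonneg hs.1 (div_nonneg (hμ0 _ _) (hD x hx).le))
  have hw1 : ∀ x : OrderSpace K, lovaszOnOrderSpace f x < c → ∀ s, ∑ A, w x.1 s A = 1 := by
    intro x hx s
    simp only [hw]
    rw [Finset.sum_add_distrib, ← Finset.mul_sum, ← Finset.mul_sum, ← Finset.sum_div,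
      sum_baryCoord x.hasLevelsIn.1, div_self (hD x hx).ne']
    ring
  have hwne : ∀ x s A, w x s A ≠ 0 → baryCoord x A ≠ 0 := by
    intro x s A h hA
    refine h ?_
    have : μ x A = 0 := by
      by_contra h'
      exact (hμne x A h').2 hA
    simp [hw, hA, this]
  have hchain : ∀ x : OrderSpace K, ∀ s A B, w x.1 s A ≠ 0 → w x.1 s B ≠ 0 → A ⊆ B ∨ B ⊆ A :=
    fun x s A B hA hB => baryCoord_chain x.hasLevelsIn.1 A B (hwne _ _ _ hA) (hwne _ _ _ hB)
  refine deformsInto_orderSubspace (fun x s => ∑ A, w x.1.1 s A • indicatorVector A) ?_ ?_ ?_ ?_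
  · refine continuous_finsetSum _ fun A _ => ?_
    have hx : Continuous fun p : {x : OrderSpace K | lovaszOnOrderSpace f x < c} × unitInterval =>
      p.1.1.1 := by fun_prop
    have hs : Continuous fun p : {x : OrderSpace K | lovaszOnOrderSpace f x < c} × unitInterval =>
      (p.2 : ℝ) := by fun_prop
    have hcont : Continuous fun p : {x : OrderSpace K | lovaszOnOrderSpace f x < c} ×
        unitInterval => w p.1.1.1 p.2 A :=
      ((continuous_const.sub hs).mul ((continuous_baryCoord A).comp hx)).add
        (hs.mul (((hμc A).comp hx).div (continuous_finsetSum _ fun B _ => (hμc B).comp hx)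
          fun p => (hD p.1.1 p.1.2).ne'))
    exact hcont.smul continuous_const
  · intro x s hs
    refine mem_realization_iff.1 (sum_smul_indicatorVector_mem_realization _ (hw0 x.1 x.2 s hs)
      (hw1 x.1 x.2 s) (fun A hA => ?_) (hchain x.1 s))
    obtain ⟨ρ, -, rfl⟩ := exists_mem_of_baryCoord_ne_zero x.1.hasLevelsIn (hwne _ _ _ hA)
    exact ⟨ρ.2, trivial⟩
  · intro x
    simpa [hw] using sum_baryCoord_smul x.1.hasLevelsIn.1
  · intro x
    refine mem_realization_iff.1 (sum_smul_indicatorVector_mem_realization _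
      (hw0 x.1 x.2 1 ⟨zero_le_one, le_rfl⟩) (hw1 x.1 x.2 1) (fun A hA => ?_) (hchain x.1 1))
    have : μ x.1.1 A ≠ 0 := fun h => hA (by simp [hw, h])
    exact (hμne _ _ this).1

end OrderSpace

/-! ### Removing a noncritical vertex from a sublevel complex. -/

theorem HasLevelsIn.lt_of_ne {V : Type*} [Fintype V] {K : AbstractSimplicialComplex V}
    {f : K.faces → ℝ} (hinj : Function.Injective f) {σ : K.faces} {x : V → ℝ}
    (hx : HasLevelsIn {ρ | f ρ ≤ f σ} x) {t : ℝ} (h0 : 0 ≤ t) (h1 : t < 1)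
    (hne : superlevel x t ≠ σ.1) :
    ∃ h : superlevel x t ∈ K.faces, (⟨_, h⟩ : K.faces) ∈ {ρ | f ρ < f σ} := by
  obtain ⟨h, hle⟩ := hx.2 t h0 h1
  exact ⟨h, lt_of_le_of_ne hle fun he => hne (congrArg Subtype.val (hinj he))⟩

section Collapse

variable {V : Type*} [Fintype V] [Nonempty V] {K : AbstractSimplicialComplex V} {f : K.faces → ℝ}

theorem outerMax_nonneg {x : V → ℝ} (hx : ∀ i, 0 ≤ x i ∧ x i ≤ 1) (A : Finset V) :
    0 ≤ outerMax x A := by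
  classical
  obtain ⟨v⟩ := ‹Nonempty V›
  refine le_trans ?_ (Finset.le_sup' _ (Finset.mem_univ v))
  split_ifs
  exacts [le_rfl, (hx v).1]

theorem innerMin_le_one {x : V → ℝ} (hx : ∀ i, 0 ≤ x i ∧ x i ≤ 1) (A : Finset V) :
    innerMin x A ≤ 1 := by
  classical
  obtain ⟨v⟩ := ‹Nonempty V›
  refine (Finset.inf'_le _ (Finset.mem_univ v)).trans ?_
  split_ifs
  exacts [(hx v).2, le_rfl]

theorem le_outerMax (x : V → ℝ) {A : Finset V} {i : V} (hi : i ∉ A) : x i ≤ outerMax x A := by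
  classical
  exact (if_neg hi).ge.trans
    (Finset.le_sup' (fun i => if i ∈ A then 0 else x i) (Finset.mem_univ i))

theorem innerMin_le (x : V → ℝ) {A : Finset V} {i : V} (hi : i ∈ A) : innerMin x A ≤ x i := by
  classical
  exact (Finset.inf'_le (fun i => if i ∈ A then x i else 1) (Finset.mem_univ i)).trans
    (if_pos hi).le

theorem HasLevelsIn.of_baryCoord_eq_zero (hinj : Function.Injective f) {σ : K.faces} {x : V → ℝ}
    (hx : HasLevelsIn {ρ | f ρ ≤ f σ} x) (h : baryCoord x σ.1 = 0) :
    HasLevelsIn {ρ | f ρ < f σ} x := by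
  refine ⟨hx.1, fun t h0 h1 => hx.lt_of_ne hinj h0 h1 fun he => ?_⟩
  have := (mem_Ico_iff_superlevel_eq hx.1 σ.1 t).2 ⟨⟨h0, h1⟩, he⟩
  have h2 := le_max_right 0 (innerMin x σ.1 - outerMax x σ.1)
  rw [baryCoord] at h
  linarith [this.1, this.2]

/-- Write τ = σ ∪ {u}. Raising `x u` across the height interval of `σ` replaces the level `σ` by
`τ`, where `f` is smaller, and changes no other level. -/
theorem deformsInto_of_mem_upperSet (hinj : Function.Injective f) (hf : IsDiscreteMorse f)
    {σ τ : K.faces} (hτ : τ ∈ upperSet f σ) :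
    DeformsInto (orderSubspace K {ρ | f ρ ≤ f σ}) (orderSubspace K {ρ | f ρ < f σ}) := by
  classical
  obtain ⟨hστ, hcard, hle⟩ := id hτ
  have hlt : f τ < f σ := lt_of_le_of_ne hle fun he => by
    rw [hinj he] at hcard
    omega
  obtain ⟨u, hu⟩ : ∃ u, τ.1 \ σ.1 = {u} := Finset.card_eq_one.1 (by
    rw [Finset.card_sdiff_of_subset hστ]
    omega)
  have hu' : u ∈ τ.1 ∧ u ∉ σ.1 := by
    rw [← Finset.mem_sdiff, hu]
    simp
  have hins : τ.1 = insert u σ.1 := by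
    rw [← Finset.sdiff_union_of_subset hστ, hu]
    rfl
  set Φ : (V → ℝ) → ℝ → V → ℝ := fun x s i =>
    x i + if i = u then s * baryCoord x σ.1 else 0 with hΦ
  have hΦu : ∀ x s, Φ x s u = x u + s * baryCoord x σ.1 := fun x s => by simp [hΦ]
  have hΦne : ∀ x s i, i ≠ u → Φ x s i = x i := fun x s i hi => by simp [hΦ, hi]
  have hfix : ∀ x s, baryCoord x σ.1 = 0 → Φ x s = x := fun x s h => by
    funext i
    simp [hΦ, h]
  have key : ∀ x, HasLevelsIn {ρ : K.faces | f ρ ≤ f σ} x → baryCoord x σ.1 ≠ 0 →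
      outerMax x σ.1 < innerMin x σ.1 ∧
        baryCoord x σ.1 = innerMin x σ.1 - outerMax x σ.1 ∧ x u = outerMax x σ.1 := by
    intro x hx h
    have hlt' : outerMax x σ.1 < innerMin x σ.1 := by
      by_contra hge
      exact h (max_eq_left (by linarith))
    refine ⟨hlt', max_eq_right (by linarith), le_antisymm (le_outerMax x hu'.2) ?_⟩
    -- Otherwise the level at height `x u` strictly contains `σ` and has value at most `f σ`, so it
    -- contains `τ`; but `u` is not in its own strict superlevel set.
    by_contra! hxu
    obtain ⟨hK, hmem⟩ := hx.2 (x u) (hx.1 u).1 (by linarith [innerMin_le_one hx.1 σ.1])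
    have hss : σ.1 ⊂ superlevel x (x u) := by
      refine Finset.ssubset_iff_subset_ne.2 ⟨fun i hi => ?_, fun he => ?_⟩
      · rw [mem_superlevel]
        linarith [innerMin_le x hi]
      · have := (mem_Ico_iff_superlevel_eq hx.1 σ.1 (x u)).2
          ⟨⟨(hx.1 u).1, by linarith [innerMin_le_one hx.1 σ.1]⟩, he.symm⟩
        linarith [this.1]
    have := hf.subset_of_mem_upperSet hτ (ρ := ⟨_, hK⟩) hss hmem hu'.1
    simp at this
  refine deformsInto_orderSubspace (fun x s => Φ x.1.1 s) ?_ ?_ ?_ ?_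
  · have hx : Continuous fun p : orderSubspace K {ρ | f ρ ≤ f σ} × unitInterval => p.1.1.1 := by
      fun_prop
    have hs : Continuous fun p : orderSubspace K {ρ | f ρ ≤ f σ} × unitInterval => (p.2 : ℝ) := by
      fun_prop
    refine continuous_pi fun i => ((continuous_apply i).comp hx).add ?_
    split_ifs
    · exact hs.mul ((continuous_baryCoord σ.1).comp hx)
    · exact continuous_const
  · intro x s hs
    have hx := mem_orderSubspace.1 x.2
    by_cases h0 : baryCoord x.1.1 σ.1 = 0
    · rw [hfix _ _ h0]
      exact x.1.hasLevelsIn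
    obtain ⟨h1, h2, h3⟩ := key _ hx h0
    have hm := innerMin_le_one hx.1 σ.1
    have hb := baryCoord_nonneg x.1.1 σ.1
    have hsb : 0 ≤ s * baryCoord x.1.1 σ.1 := mul_nonneg hs.1 hb
    have hsb' : s * baryCoord x.1.1 σ.1 ≤ baryCoord x.1.1 σ.1 := mul_le_of_le_one_left hb hs.2
    have hge : ∀ i, x.1.1 i ≤ Φ x.1.1 s i := by
      intro i
      by_cases hi : i = u
      · rw [hi, hΦu]
        linarith
      · rw [hΦne _ _ _ hi]
    refine hasLevelsIn_univ_of (fun i => ⟨(hx.1 i).1.trans (hge i), ?_⟩) ?_ ?_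
    · by_cases hi : i = u
      · rw [hi, hΦu]
        linarith
      · rw [hΦne _ _ _ hi]
        exact (hx.1 i).2
    · obtain ⟨i, hi⟩ := hx.exists_eq_one
      refine ⟨i, ?_⟩
      rw [hΦne, hi]
      rintro rfl
      linarith
    · have hne : (superlevel (Φ x.1.1 s) 0).Nonempty := by
        obtain ⟨i, hi⟩ := hx.exists_eq_one
        exact ⟨i, mem_superlevel.2 (by linarith [hge i])⟩
      -- If the interval of `σ` starts at height 0, the lowest level stays inside `τ`; otherwise `u`
      -- already belongs to the lowest level of `x`.
      rcases (outerMax_nonneg hx.1 σ.1).eq_or_lt with hb0 | hb0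
      · refine face_of_subset τ (fun i hi => ?_) hne
        have hσ := ((mem_Ico_iff_superlevel_eq hx.1 σ.1 0).1 ⟨hb0.ge, hb0 ▸ h1⟩).2
        rw [hins, Finset.mem_insert]
        by_cases hiu : i = u
        · exact Or.inl hiu
        · right
          rw [← hσ]
          simpa [hΦne _ _ _ hiu] using hi
      · obtain ⟨hK, -⟩ := hx.2 0 le_rfl one_pos
        refine face_of_subset ⟨_, hK⟩ (fun i hi => ?_) hne
        by_cases hiu : i = u
        · rw [hiu]
          simpa [h3] using hb0
        · simpa [hΦne _ _ _ hiu] using hi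
  · intro x
    funext i
    simp [hΦ]
  · intro x
    have hx := mem_orderSubspace.1 x.2
    by_cases h0 : baryCoord x.1.1 σ.1 = 0
    · rw [hfix _ _ h0]
      exact hx.of_baryCoord_eq_zero hinj h0
    obtain ⟨h1, h2, h3⟩ := key _ hx h0
    have hu1 : Φ x.1.1 1 u = innerMin x.1.1 σ.1 := by
      rw [hΦu]
      linarith
    have hm := innerMin_le_one hx.1 σ.1
    have hb := outerMax_nonneg hx.1 σ.1
    refine ⟨fun i => ?_, fun t ht0 ht1 => ?_⟩
    · by_cases hi : i = u
      · rw [hi, hu1]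
        exact ⟨by linarith, hm⟩
      · rw [hΦne _ _ _ hi]
        exact hx.1 i
    · by_cases hmid : t ∈ Set.Ico (outerMax x.1.1 σ.1) (innerMin x.1.1 σ.1)
      · have hσ := ((mem_Ico_iff_superlevel_eq hx.1 σ.1 t).1 hmid).2
        have : superlevel (Φ x.1.1 1) t = τ.1 := by
          rw [hins, ← hσ]
          ext i
          by_cases hi : i = u
          · simp [hi, hu1, hmid.2]
          · simp [hΦne _ _ _ hi, hi]
        rw [this]
        exact ⟨τ.2, hlt⟩
      · have hsame : superlevel (Φ x.1.1 1) t = superlevel x.1.1 t := by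
          ext i
          rw [mem_superlevel, mem_superlevel]
          by_cases hi : i = u
          · rw [hi, hu1, h3]
            rw [Set.mem_Ico, not_and_or, not_le, not_lt] at hmid
            rcases hmid with h | h
            · exact ⟨fun _ => h, fun _ => h.trans h1⟩
            · exact ⟨fun h' => by linarith, fun h' => by linarith⟩
          · rw [hΦne _ _ _ hi]
        rw [hsame]
        refine hx.lt_of_ne hinj ht0 ht1 fun he => hmid ?_
        exact (mem_Ico_iff_superlevel_eq hx.1 σ.1 t).2 ⟨⟨ht0, ht1⟩, he⟩

/-- Write σ = ν ∪ {v}. Raising `x v` and lowering the smallest coordinates of `ν` destroys the level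
`σ`. The new levels are proper subsets of `σ` that contain `v`, hence do not lie in `ν`, and
`subset_of_mem_lowerSet` gives them values below `f σ`. -/
theorem deformsInto_of_mem_lowerSet (hinj : Function.Injective f) (hf : IsDiscreteMorse f)
    {σ ν : K.faces} (hν : ν ∈ lowerSet f σ) :
    DeformsInto (orderSubspace K {ρ | f ρ ≤ f σ}) (orderSubspace K {ρ | f ρ < f σ}) := by
  classical
  obtain ⟨hνσ, hcard, hle⟩ := id hν
  have hlt : f σ < f ν := lt_of_le_of_ne hle fun he => by
    rw [hinj he] at hcard
    omega
  obtain ⟨v, hv⟩ : ∃ v, σ.1 \ ν.1 = {v} := Finset.card_eq_one.1 (by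
    rw [Finset.card_sdiff_of_subset hνσ]
    omega)
  obtain ⟨hvσ, hvν⟩ : v ∈ σ.1 ∧ v ∉ ν.1 := by
    rw [← Finset.mem_sdiff, hv]
    simp
  have hins : σ.1 = insert v ν.1 := by
    rw [← Finset.sdiff_union_of_subset hνσ, hv]
    rfl
  -- With i₀ = `innerMin x σ.1` and d = `s * baryCoord x σ.1`, the second case stretches [i₀, i₀ +
  -- d] linearly onto [i₀ - d, i₀ + d] and fixes everything above. At s = 1 the minimum i₀ lands on
  -- `outerMax x σ.1`.
  set Φ : (V → ℝ) → ℝ → V → ℝ := fun x s i =>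
    if i = v then min 1 (x i + s * baryCoord x σ.1)
    else if i ∈ ν.1 then min (x i) (2 * x i - innerMin x σ.1 - s * baryCoord x σ.1)
    else x i with hΦ
  have hΦv : ∀ x s, Φ x s v = min 1 (x v + s * baryCoord x σ.1) := fun x s => by simp [hΦ]
  have hΦν : ∀ x s, ∀ i ∈ ν.1,
      Φ x s i = min (x i) (2 * x i - innerMin x σ.1 - s * baryCoord x σ.1) := fun x s i hi => by
    have : i ≠ v := fun h => hvν (h ▸ hi)
    simp [hΦ, hi, this]
  have hΦo : ∀ x s i, i ∉ σ.1 → Φ x s i = x i := fun x s i hi => by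
    rw [hins, Finset.mem_insert, not_or] at hi
    simp [hΦ, hi]
  have hcases : ∀ i, i = v ∨ i ∈ ν.1 ∨ i ∉ σ.1 := fun i => by
    rw [hins, Finset.mem_insert]
    tauto
  have hstill : ∀ x, (∀ i, 0 ≤ x i ∧ x i ≤ 1) → ∀ s, s * baryCoord x σ.1 = 0 → Φ x s = x := by
    intro x hx s h
    funext i
    rcases hcases i with rfl | hi | hi
    · rw [hΦv, h, add_zero, min_eq_right (hx i).2]
    · rw [hΦν _ _ _ hi, h, min_eq_left]
      linarith [innerMin_le x (hνσ hi)]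
    · exact hΦo _ _ _ hi
  have key : ∀ x, HasLevelsIn {ρ : K.faces | f ρ ≤ f σ} x → baryCoord x σ.1 ≠ 0 →
      outerMax x σ.1 < innerMin x σ.1 ∧
        baryCoord x σ.1 = innerMin x σ.1 - outerMax x σ.1 ∧
        ∃ w ∈ ν.1, x w = innerMin x σ.1 := by
    intro x hx h
    have hlt' : outerMax x σ.1 < innerMin x σ.1 := by
      by_contra hge
      exact h (max_eq_left (by linarith))
    refine ⟨hlt', max_eq_right (by linarith), ?_⟩
    -- If only `v` attained the minimum, the level there would be exactly `ν`, but `f ν > f σ`.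
    by_contra! hne
    have hgt : ∀ w ∈ ν.1, innerMin x σ.1 < x w := fun w hw =>
      lt_of_le_of_ne (innerMin_le x (hνσ hw)) (hne w hw).symm
    obtain ⟨w, hw⟩ := (K.isRelLowerSet_faces ν.2).1
    have hm1 : innerMin x σ.1 < 1 := (hgt w hw).trans_le (hx.1 w).2
    have hm0 : 0 ≤ innerMin x σ.1 := (outerMax_nonneg hx.1 σ.1).trans hlt'.le
    obtain ⟨hK, hmem⟩ := hx.2 _ hm0 hm1
    have hsub : superlevel x (innerMin x σ.1) ⊆ σ.1 := by
      intro i hi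
      rw [mem_superlevel] at hi
      by_contra hiσ
      linarith [le_outerMax x hiσ]
    have hsup : ν.1 ⊆ superlevel x (innerMin x σ.1) := fun i hi => mem_superlevel.2 (hgt i hi)
    have hneσ : superlevel x (innerMin x σ.1) ≠ σ.1 := fun he =>
      absurd ((mem_Ico_iff_superlevel_eq hx.1 σ.1 _).2 ⟨⟨hm0, hm1⟩, he⟩).2 (lt_irrefl _)
    have hcl := Finset.card_lt_card (Finset.ssubset_iff_subset_ne.2 ⟨hsub, hneσ⟩)
    have heq : ν = ⟨superlevel x (innerMin x σ.1), hK⟩ :=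
      Subtype.ext (Finset.eq_of_subset_of_card_le hsup (Nat.lt_succ_iff.1 (hcl.trans_eq hcard.symm)))
    rw [← heq] at hmem
    exact absurd hlt (not_lt.2 hmem)
  refine deformsInto_orderSubspace (fun x s => Φ x.1.1 s) ?_ ?_ ?_ ?_
  · have hx : Continuous fun p : orderSubspace K {ρ | f ρ ≤ f σ} × unitInterval => p.1.1.1 := by
      fun_prop
    have hs : Continuous fun p : orderSubspace K {ρ | f ρ ≤ f σ} × unitInterval => (p.2 : ℝ) := by
      fun_prop
    have hsb := hs.mul ((continuous_baryCoord σ.1).comp hx)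
    refine continuous_pi fun i => ?_
    have hxi := (continuous_apply i).comp hx
    simp only [hΦ]
    split_ifs
    · exact continuous_const.min (hxi.add hsb)
    · exact hxi.min (((continuous_const.mul hxi).sub ((continuous_innerMin σ.1).comp hx)).sub hsb)
    · exact hxi
  · intro x s hs
    have hx := mem_orderSubspace.1 x.2
    by_cases h0 : baryCoord x.1.1 σ.1 = 0
    · rw [hstill _ hx.1 _ (by rw [h0, mul_zero])]
      exact x.1.hasLevelsIn
    obtain ⟨h1, h2, w, hw, hxw⟩ := key _ hx h0
    have hm := innerMin_le_one hx.1 σ.1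
    have ho := outerMax_nonneg hx.1 σ.1
    have hb := baryCoord_nonneg x.1.1 σ.1
    have hsb : 0 ≤ s * baryCoord x.1.1 σ.1 := mul_nonneg hs.1 hb
    have hsb' : s * baryCoord x.1.1 σ.1 ≤ baryCoord x.1.1 σ.1 := mul_le_of_le_one_left hb hs.2
    have hxv := innerMin_le x.1.1 hvσ
    have hone : ∃ i, Φ x.1.1 s i = 1 := by
      obtain ⟨i, hi⟩ := hx.exists_eq_one
      rcases hcases i with rfl | hiν | hio
      · refine ⟨i, ?_⟩
        rw [hΦv, min_eq_left]
        linarith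
      -- Either the stretch stops below 1 and `i` keeps the value 1, or `v` has been raised to the
      -- cap 1.
      · by_cases hsm : s * baryCoord x.1.1 σ.1 ≤ 1 - innerMin x.1.1 σ.1
        · refine ⟨i, ?_⟩
          rw [hΦν _ _ _ hiν, hi, min_eq_left]
          linarith
        · refine ⟨v, ?_⟩
          rw [hΦv, min_eq_left]
          linarith
      · exact ⟨i, by rw [hΦo _ _ _ hio, hi]⟩
    refine hasLevelsIn_univ_of (fun i => ?_) hone ?_
    · rcases hcases i with rfl | hiν | hio
      · rw [hΦv]
        exact ⟨le_min zero_le_one (by linarith), min_le_left _ _⟩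
      · rw [hΦν _ _ _ hiν]
        have := innerMin_le x.1.1 (hνσ hiν)
        exact ⟨le_min (hx.1 i).1 (by linarith), (min_le_left _ _).trans (hx.1 i).2⟩
      · rw [hΦo _ _ _ hio]
        exact hx.1 i
    · obtain ⟨hK, -⟩ := hx.2 0 le_rfl one_pos
      refine face_of_subset ⟨_, hK⟩ (fun i hi => ?_) ?_
      · rw [mem_superlevel] at hi ⊢
        rcases hcases i with rfl | hiν | hio
        · linarith
        · rw [hΦν _ _ _ hiν] at hi
          exact hi.trans_le (min_le_left _ _)
        · rwa [hΦo _ _ _ hio] at hi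
      · obtain ⟨i, hi⟩ := hone
        exact ⟨i, by simp [hi]⟩
  · intro x
    exact hstill _ x.1.hasLevelsIn.1 _ (zero_mul _)
  · intro x
    have hx := mem_orderSubspace.1 x.2
    by_cases h0 : baryCoord x.1.1 σ.1 = 0
    · rw [hstill _ hx.1 _ (by rw [h0, mul_zero])]
      exact hx.of_baryCoord_eq_zero hinj h0
    obtain ⟨h1, h2, w, hw, hxw⟩ := key _ hx h0
    have hm := innerMin_le_one hx.1 σ.1
    have ho := outerMax_nonneg hx.1 σ.1
    have hxv := innerMin_le x.1.1 hvσ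
    have hν' : ∀ i ∈ ν.1, Φ x.1.1 1 i =
        min (x.1.1 i) (2 * x.1.1 i - innerMin x.1.1 σ.1 - baryCoord x.1.1 σ.1) := fun i hi => by
      rw [hΦν _ _ _ hi, one_mul]
    have hv' : Φ x.1.1 1 v = min 1 (x.1.1 v + baryCoord x.1.1 σ.1) := by rw [hΦv, one_mul]
    have hνge : ∀ i ∈ ν.1, outerMax x.1.1 σ.1 ≤ Φ x.1.1 1 i := fun i hi => by
      have := innerMin_le x.1.1 (hνσ hi)
      rw [hν' i hi]
      exact le_min (by linarith) (by linarith)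
    refine ⟨fun i => ?_, fun t ht0 ht1 => ?_⟩
    · rcases hcases i with rfl | hiν | hio
      · rw [hv']
        exact ⟨le_min zero_le_one (by linarith), min_le_left _ _⟩
      · refine ⟨ho.trans (hνge i hiν), ?_⟩
        rw [hν' i hiν]
        exact (min_le_left _ _).trans (hx.1 i).2
      · rw [hΦo _ _ _ hio]
        exact hx.1 i
    rcases lt_or_ge t (outerMax x.1.1 σ.1) with ht | ht
    · have hsame : superlevel (Φ x.1.1 1) t = superlevel x.1.1 t := by
        ext i
        rw [mem_superlevel, mem_superlevel]
        rcases hcases i with rfl | hiν | hio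
        · rw [hv']
          exact ⟨fun _ => by linarith, fun _ => lt_min ht1 (by linarith)⟩
        · have := innerMin_le x.1.1 (hνσ hiν)
          exact ⟨fun _ => by linarith, fun _ => ht.trans_le (hνge i hiν)⟩
        · rw [hΦo _ _ _ hio]
      rw [hsame]
      refine hx.lt_of_ne hinj ht0 ht1 fun he => ?_
      exact absurd ((mem_Ico_iff_superlevel_eq hx.1 σ.1 t).2 ⟨⟨ht0, ht1⟩, he⟩).1 (not_le.2 ht)
    -- While `v` is present, `w` has dropped out of the level, so the inclusion in `σ` is strict.
    -- Once `v` is absent, `t` lies above the stretched range and the level is that of `x`.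
    · by_cases hvt : v ∈ superlevel (Φ x.1.1 1) t
      · have hsub : superlevel (Φ x.1.1 1) t ⊂ σ.1 := by
          refine (Finset.ssubset_iff_of_subset fun i hi => ?_).2 ⟨w, hνσ hw, ?_⟩
          · by_contra hio
            rw [mem_superlevel, hΦo _ _ _ hio] at hi
            linarith [le_outerMax x.1.1 hio]
          · rw [mem_superlevel, hν' w hw, not_lt]
            refine (min_le_right _ _).trans ?_
            linarith
        refine ⟨face_of_subset σ hsub.1 ⟨v, hvt⟩, ?_⟩
        by_contra hge
        exact hvν (hf.subset_of_mem_lowerSet hν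
          (ρ := ⟨_, face_of_subset σ hsub.1 ⟨v, hvt⟩⟩) hsub (not_lt.1 hge) hvt)
      · have hvt' : x.1.1 v + baryCoord x.1.1 σ.1 ≤ t := by
          rw [mem_superlevel, hv', not_lt, min_le_iff] at hvt
          rcases hvt with h | h
          · linarith
          · exact h
        have hsame : superlevel (Φ x.1.1 1) t = superlevel x.1.1 t := by
          ext i
          rcases hcases i with rfl | hiν | hio
          · refine ⟨fun h => (hvt h).elim, fun h => ?_⟩
            rw [mem_superlevel] at h
            linarith
          · rw [mem_superlevel, mem_superlevel, hν' i hiν, lt_min_iff]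
            exact ⟨fun h => h.1, fun h => ⟨h, by linarith⟩⟩
          · rw [mem_superlevel, mem_superlevel, hΦo _ _ _ hio]
        rw [hsame] at hvt ⊢
        exact hx.lt_of_ne hinj ht0 ht1 fun he => hvt (he ▸ hvσ)

end Collapse

/-! ### The min-max principle. -/

theorem mem_continuousCatClass_of_deformsInto {V : Type*}
    {K : AbstractSimplicialComplex V} {m : ℕ} {S T : Set (OrderSpace K)}
    (hS : S ∈ continuousCatClass K m) (h : DeformsInto S T) : T ∈ continuousCatClass K m :=
  ⟨h.nonempty hS.1, hS.2.trans h.lsCat_le⟩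

section MinMax

variable {V : Type*} [Fintype V] [Nonempty V] {K : AbstractSimplicialComplex V} {f : K.faces → ℝ}
  {m : ℕ}

theorem mem_discreteCatClass_of_deformsInto {S : Set (OrderSpace K)} {L : Set K.faces}
    (hS : S ∈ continuousCatClass K m) (h : DeformsInto S (orderSubspace K L)) :
    L ∈ discreteCatClass K m :=
  ⟨nonempty_of_orderSubspace_nonempty (h.nonempty hS.1), hS.2.trans h.lsCat_le⟩

theorem orderSubspace_mem_continuousCatClass {L : Set K.faces} (hL : L ∈ discreteCatClass K m) :
    orderSubspace K L ∈ continuousCatClass K m := by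
  obtain ⟨σ, hσ⟩ := hL.1
  exact ⟨⟨vertexPoint σ, mem_orderSubspace.2 (hasLevelsIn_indicatorVector hσ)⟩, hL.2⟩

theorem discreteCatClass_nonempty_iff :
    (discreteCatClass K m).Nonempty ↔ (continuousCatClass K m).Nonempty := by
  constructor
  · rintro ⟨L, hL⟩
    exact ⟨_, orderSubspace_mem_continuousCatClass hL⟩
  · rintro ⟨S, hS⟩
    refine ⟨Set.univ, mem_discreteCatClass_of_deformsInto hS (.of_subset ?_)⟩
    rw [orderSubspace_univ]
    exact Set.subset_univ S

end MinMax

end DiscreteMorseLS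

theorem mainTheorem3 {V : Type*} [Fintype V] [Nonempty V] (K : AbstractSimplicialComplex V)
    (f : K.faces → ℝ) (hinj : Function.Injective f) (hf : DiscreteMorseLS.IsDiscreteMorse f)
    (m : ℕ) (hm : m ≤ DiscreteMorseLS.dimension K) :
    ((DiscreteMorseLS.discreteCatClass K m).Nonempty ↔
        (DiscreteMorseLS.continuousCatClass K m).Nonempty) ∧
      ((DiscreteMorseLS.discreteCatClass K m).Nonempty →
        ∃ c : ℝ,
          IsLeast {a : ℝ | ∃ L ∈ DiscreteMorseLS.discreteCatClass K m, IsGreatest (f '' L) a} c ∧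
          IsGLB {b : ℝ | ∃ S ∈ DiscreteMorseLS.continuousCatClass K m,
            IsLUB (DiscreteMorseLS.lovaszOnOrderSpace f '' S) b} c ∧
          DiscreteMorseLS.IsDiscreteCriticalValue f c ∧
          DiscreteMorseLS.IsMetricCriticalValue (DiscreteMorseLS.lovaszOnOrderSpace f) c) := by
  classical
  open DiscreteMorseLS in
  refine ⟨discreteCatClass_nonempty_iff, fun hne => ?_⟩
  set A : Set ℝ := {a : ℝ | ∃ L ∈ discreteCatClass K m, IsGreatest (f '' L) a} with hA
  -- Each member of `A` is a value of `f` on the finite set of faces, so the minimum is attained.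
  have hAfin : A.Finite := (Set.finite_range f).subset fun a ha => by
    obtain ⟨L, -, ⟨σ, -, h⟩, -⟩ := ha
    exact ⟨σ, h⟩
  have hgreatest : ∀ L ∈ discreteCatClass K m, ∃ a ∈ A, IsGreatest (f '' L) a := by
    intro L hL
    obtain ⟨a, ha, hmax⟩ := Set.exists_max_image (f '' L) id (Set.toFinite _) (hL.1.image f)
    exact ⟨a, ⟨L, hL, ha, hmax⟩, ha, hmax⟩
  have hAne : A.Nonempty := by
    obtain ⟨L, hL⟩ := hne
    obtain ⟨a, ha, -⟩ := hgreatest L hL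
    exact ⟨a, ha⟩
  obtain ⟨c, hcA, hcmin⟩ := Set.exists_min_image A id hAfin hAne
  have hc : IsLeast A c := ⟨hcA, hcmin⟩
  obtain ⟨L, hL, ⟨σ, hσL, rfl⟩, hmax⟩ := id hc.1
  have hlow : {ρ | f ρ < f σ} ∉ discreteCatClass K m := fun h => by
    obtain ⟨a, ha, ⟨ρ, hρ, rfl⟩, -⟩ := hgreatest _ h
    exact absurd (hc.2 ha) (not_le.2 hρ)
  have hsub : orderSubspace K {ρ | f ρ ≤ f σ} ∈ continuousCatClass K m :=
    mem_continuousCatClass_of_deformsInto (orderSubspace_mem_continuousCatClass hL)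
      (.of_subset (orderSubspace_mono fun ρ hρ => hmax ⟨ρ, hρ, rfl⟩))
  have hcont : {x : OrderSpace K | lovaszOnOrderSpace f x < f σ} ∉ continuousCatClass K m :=
    fun h => hlow (mem_discreteCatClass_of_deformsInto h (deformsInto_strict_sublevel f (f σ)))
  refine ⟨f σ, hc, ⟨?_, ?_⟩, ⟨σ, ?_, ?_, rfl⟩, vertexPoint σ, ?_, lovaszOnOrderSpace_vertexPoint σ⟩
  · rintro b ⟨S, hS, hb⟩
    by_contra! hlt
    refine hcont (mem_continuousCatClass_of_deformsInto hS (.of_subset fun x hx => ?_))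
    exact (hb.1 ⟨x, hx, rfl⟩).trans_lt hlt
  · intro b hb
    -- The set |S_K({f ≤ f σ})| realizes the infimum: F is at most `f σ` on it, with equality at
    -- `vertexPoint σ`.
    refine hb ⟨_, hsub, ?_, fun d hd => ?_⟩
    · rintro _ ⟨x, hx, rfl⟩
      exact lovaszOnOrderSpace_le (fun _ h => h) hx
    · rw [← lovaszOnOrderSpace_vertexPoint (f := f) σ]
      exact hd ⟨_, mem_orderSubspace.2 (hasLevelsIn_indicatorVector (le_refl (f σ))), rfl⟩
  · by_contra hU
    obtain ⟨τ, hτ⟩ := Set.nonempty_iff_ne_empty.2 hU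
    exact hlow (mem_discreteCatClass_of_deformsInto hsub (deformsInto_of_mem_upperSet hinj hf hτ))
  · by_contra hU
    obtain ⟨ν, hν⟩ := Set.nonempty_iff_ne_empty.2 hU
    exact hlow (mem_discreteCatClass_of_deformsInto hsub (deformsInto_of_mem_lowerSet hinj hf hν))
  · by_contra hslope
    refine hcont (mem_continuousCatClass_of_deformsInto hsub ?_)
    have := DeformsInto.of_weakSlope_ne_zero hslope
      (S := orderSubspace K {ρ | f ρ ≤ f σ}) fun x hx hxne => by
        rw [lovaszOnOrderSpace_vertexPoint]
        exact lovaszOnOrderSpace_lt hinj hx hxne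
    rwa [lovaszOnOrderSpace_vertexPoint] at this
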